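/- Let $T$ be a caterpillar tree with $n \ge 1$ vertices and vertex degrees $k_1,\dots,k_n$, that is, a finite tree such that removing all its leaves (vertices of degree one) leaves a linear tree (a tree with maximum degree at most two) or no vertex at all. The latter happens only for $n=2$. A linear arrangement of $T$ is a bijection $\pi$ from its vertices to $n$ consecutive integer positions. Let $$D_{min}^{cat} = \min_{\pi} \sum_{\{u,v\}\in E(T)} |\pi(u)-\pi(v)|$$ be the minimum of the sum of edge lengths over all $n!$ linear arrangements of $T$. Let $\langle k^2\rangle = \frac1n\sum_{i=1}^n k_i^2$ and let $q$ be the number of vertices of odd degree. Then $$D_{min}^{cat} = n-1+\sum_{i=1}^n\left\lfloor \tfrac14 (k_i-1)^2\right\rfloor = \sum_{i=1}^n \left\lfloor \tfrac14 (k_i+1)^2\right\rfloor - (n-1) = \tfrac14\left(n\langle k^2\rangle + q\right).$$ -/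

import Mathlib

section LinearArrangements

/-- A linear arrangement of a finite vertex set: a bijection onto the `n` consecutive
positions, `n` being the number of vertices. -/
abbrev LinearArrangement (V : Type*) [Fintype V] : Type _ := V ≃ Fin (Fintype.card V)

/-- The length of the pair `{u, v}` under the arrangement `π`: the absolute value of the
difference between the positions of `u` and `v`. -/
def LinearArrangement.edgeLength {V : Type*} [Fintype V] (π : LinearArrangement V) :
    Sym2 V → ℕ :=
  Sym2.lift ⟨fun u v => ((π u : ℤ) - (π v : ℤ)).natAbs, fun u v => by
    dsimp only; omega⟩

namespace SimpleGraph

variable {V : Type*} [Fintype V] [DecidableEq V] (G : SimpleGraph V) [DecidableRel G.Adj]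

/-- `D`: the sum of the edge lengths of `G` under the linear arrangement `π`. -/
def sumEdgeLengths (π : LinearArrangement V) : ℕ :=
  ∑ e ∈ G.edgeFinset, π.edgeLength e

/-- `D_min`: the minimum of the sum of edge lengths over all `n!` linear arrangements. -/
def minSumEdgeLengths : ℕ :=
  Finset.univ.inf' (Finset.univ_nonempty_iff.mpr (Fintype.truncEquivFin V).nonempty)
    (fun π : LinearArrangement V => G.sumEdgeLengths π)

/-- A linear tree: a tree whose vertices have degree at most two. -/
def IsLinearTree {W : Type*} (H : SimpleGraph W) [H.LocallyFinite] : Prop :=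
  H.IsTree ∧ ∀ w, H.degree w ≤ 2

/-- A caterpillar tree: a tree such that the removal of all its leaves (the vertices of
degree one) leaves a linear tree. The only tree that consists of leaves alone is the
edge with its two end vertices; nothing is left of it, and it counts as a caterpillar. -/
def IsCaterpillar : Prop :=
  G.IsTree ∧ (IsEmpty {v : V | G.degree v ≠ 1} ∨ (G.induce {v : V | G.degree v ≠ 1}).IsLinearTree)

/-- The second moment about zero of the vertex degrees. -/
def degreeSecondMoment : ℚ :=
  (∑ v, (G.degree v : ℚ) ^ 2) / (Fintype.card V : ℚ)

/-- The number of vertices of odd degree. -/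
def numOddDegree : ℕ :=
  (Finset.univ.filter (fun v => Odd (G.degree v))).card

end SimpleGraph

end LinearArrangements

/-!
The length of an edge `uv` in an arrangement is one more than the number of vertices strictly
between `u` and `v`, so the sum of edge lengths is the number of edges plus the number of covered
triples `(u, x, v)`, where `uv` is an edge and `x` lies strictly between its ends
(`SimpleGraph.sumEdgeLengths_eq_card_add_card_coveredTriples`).

Lower bound. Any two neighbours of `v` on the same side of `v` give a covered triple: the edge from
`v` to the farther one covers the nearer one. A covered triple arises from two different vertices
`v` only if `x` is adjacent to both ends of the edge, which would be a triangle. Hence in a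
triangle-free graph the number of covered triples is at least the sum over all vertices of
`C(l, 2) + C(r, 2)`, where `l` and `r` count the neighbours on the two sides; this is at least
`⌊(k - 1)² / 4⌋` for `k = l + r` (`SimpleGraph.card_add_sum_minSameSidePairs_le_sumEdgeLengths`).

Attainment. Equality holds as soon as every covered vertex is adjacent to an end of the covering
edge and every vertex has its neighbours split evenly
(`SimpleGraph.sumEdgeLengths_eq_of_tied_of_balanced`). In a caterpillar, the vertices of degree
different from one form a path; the distance from one end of it is an injective coordinate
(`SimpleGraph.IsLinearTree.exists_coordinate`). Laying these vertices out in the order of the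
coordinate, each surrounded by its own leaves in suitable numbers, gives such an arrangement
(`SimpleGraph.Connected.exists_tied_balanced_arrangement`).

The three formulas then follow from the degree sum `2 (n - 1)` of a tree.
-/

open Finset

/-! ### Arithmetic of the balanced split -/

/-- The least number of pairs on one side when `k` points are split between two sides,
that is `⌊(k - 1)² / 4⌋`; the split is then into `k / 2` and `k - k / 2` points. -/
def minSameSidePairs (k : ℕ) : ℕ := (k / 2) * ((k - 1) / 2)

lemma four_mul_minSameSidePairs (k : ℕ) :
    4 * minSameSidePairs k + 2 * k = k ^ 2 + if Odd k then 1 else 0 := by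
  unfold minSameSidePairs
  obtain ⟨m, rfl | rfl⟩ := k.even_or_odd'
  · rcases m with _ | m
    · simp
    · have h1 : 2 * (m + 1) / 2 = m + 1 := by omega
      have h2 : (2 * (m + 1) - 1) / 2 = m := by omega
      rw [h1, h2, if_neg (by simp)]
      ring
  · have h1 : (2 * m + 1) / 2 = m := by omega
    have h2 : (2 * m + 1 - 1) / 2 = m := by omega
    rw [h1, h2, if_pos (by simp)]
    ring

lemma choose_two_mul_two (m : ℕ) : (m.choose 2 : ℤ) * 2 = m * (m - 1) := by
  have h : ((m.choose 2 : ℕ) : ℚ) * 2 = m * (m - 1) := by rw [Nat.cast_choose_two]; ring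
  exact_mod_cast h

lemma minSameSidePairs_le (l r : ℕ) :
    minSameSidePairs (l + r) ≤ l.choose 2 + r.choose 2 := by
  have h := four_mul_minSameSidePairs (l + r)
  have hl := choose_two_mul_two l
  have hr := choose_two_mul_two r
  have hodd : (if Odd (l + r) then 1 else 0 : ℤ) ≤ ((l : ℤ) - r) ^ 2 := by
    split_ifs with ho
    · have : (l : ℤ) - r ≠ 0 := by
        intro h0
        obtain ⟨m, hm⟩ := ho
        omega
      have := sq_pos_of_ne_zero this
      omega
    · positivity
  zify at h ⊢
  nlinarith

lemma choose_two_add_choose_two_of_balanced {l r : ℕ} (h₁ : l ≤ r + 1) (h₂ : r ≤ l + 1) :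
    l.choose 2 + r.choose 2 = minSameSidePairs (l + r) := by
  have h := four_mul_minSameSidePairs (l + r)
  have hl := choose_two_mul_two l
  have hr := choose_two_mul_two r
  obtain rfl | rfl | rfl : l = r ∨ l = r + 1 ∨ r = l + 1 := by omega
  · rw [if_neg (by simp)] at h
    zify at h ⊢
    nlinarith
  · rw [if_pos ⟨r, by ring⟩] at h
    zify at h ⊢
    push_cast at h hl
    nlinarith
  · rw [if_pos ⟨l, by ring⟩] at h
    zify at h ⊢
    push_cast at h hr
    nlinarith

lemma floor_quarter_sub_one_sq (k : ℕ) :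
    ⌊(1 / 4 : ℚ) * ((k : ℚ) - 1) ^ 2⌋ = minSameSidePairs k := by
  have h := four_mul_minSameSidePairs k
  rw [Int.floor_eq_iff]
  have hq : (4 * (minSameSidePairs k : ℚ) + 2 * k = k ^ 2 + if Odd k then 1 else 0) := by
    exact_mod_cast h
  split_ifs at hq <;> push_cast <;> constructor <;> nlinarith

lemma floor_quarter_add_one_sq (k : ℕ) :
    ⌊(1 / 4 : ℚ) * ((k : ℚ) + 1) ^ 2⌋ = minSameSidePairs k + k := by
  have h : (1 / 4 : ℚ) * ((k : ℚ) + 1) ^ 2 = (1 / 4 : ℚ) * ((k : ℚ) - 1) ^ 2 + (k : ℤ) := by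
    push_cast; ring
  rw [h, Int.floor_add_intCast, floor_quarter_sub_one_sq]

lemma card_filter_lt_eq_choose_two {α β : Type*} [DecidableEq α] [LinearOrder β]
    (S : Finset α) {f : α → β} (hf : f.Injective) :
    #((S ×ˢ S).filter fun p => f p.1 < f p.2) = (#S).choose 2 := by
  have hswap : #((S ×ˢ S).filter fun p => f p.2 < f p.1) =
      #((S ×ˢ S).filter fun p => f p.1 < f p.2) := by
    refine card_nbij' Prod.swap Prod.swap ?_ ?_ ?_ ?_ <;> intro p <;> simp <;> tauto
  have hunion : S.offDiag = ((S ×ˢ S).filter fun p => f p.1 < f p.2) ∪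
      ((S ×ˢ S).filter fun p => f p.2 < f p.1) := by
    ext p
    simp only [mem_offDiag, mem_union, mem_filter, mem_product, ← hf.ne_iff, ne_iff_lt_or_gt]
    tauto
  have hdisj : Disjoint ((S ×ˢ S).filter fun p => f p.1 < f p.2)
      ((S ×ˢ S).filter fun p => f p.2 < f p.1) :=
    disjoint_filter.2 fun p _ h => not_lt_of_gt h
  have hcard := congrArg card hunion
  rw [card_union_of_disjoint hdisj, hswap, offDiag_card] at hcard
  rw [Nat.choose_two_right, Nat.mul_sub, mul_one]
  omega

namespace SimpleGraph

/-! ### Edge lengths and covered vertices -/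

section Counting

variable {V : Type*} [Fintype V] (G : SimpleGraph V) [DecidableRel G.Adj]
  (π : LinearArrangement V)

/-- The neighbours of `v` placed to the left of `v`. -/
def leftNeighbors (v : V) : Finset V := (G.neighborFinset v).filter fun w => π w < π v

/-- The neighbours of `v` placed to the right of `v`. -/
def rightNeighbors (v : V) : Finset V := (G.neighborFinset v).filter fun w => π v < π w

/-- The triples `(u, x, v)` in which the edge `uv`, with `u` on the left, covers the vertex `x`
strictly between its ends. -/
def coveredTriples : Finset (V × V × V) :=
  univ.filter fun t => G.Adj t.1 t.2.2 ∧ π t.1 < π t.2.1 ∧ π t.2.1 < π t.2.2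

/-- The covered triples `(u, x, v)` in which `x` is adjacent to the left end `u`. -/
def leftTiedTriples : Finset (V × V × V) :=
  (G.coveredTriples π).filter fun t => G.Adj t.1 t.2.1

/-- The covered triples `(u, x, v)` in which `x` is adjacent to the right end `v`. -/
def rightTiedTriples : Finset (V × V × V) :=
  (G.coveredTriples π).filter fun t => G.Adj t.2.1 t.2.2

lemma card_leftNeighbors_add_card_rightNeighbors (v : V) :
    #(G.leftNeighbors π v) + #(G.rightNeighbors π v) = G.degree v := by
  rw [← card_neighborFinset_eq_degree,
    ← card_filter_add_card_filter_not (s := G.neighborFinset v) fun w => π w < π v]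
  unfold leftNeighbors rightNeighbors
  congr 2
  refine filter_congr fun w hw => ?_
  have : π v ≠ π w := π.injective.ne (G.ne_of_adj (by simpa using hw))
  rw [not_lt]
  exact ⟨le_of_lt, fun h => lt_of_le_of_ne h this⟩

lemma sum_edgeFinset_eq_sum_oriented (f : Sym2 V → ℕ) :
    ∑ e ∈ G.edgeFinset, f e =
      ∑ p ∈ univ.filter (fun p : V × V => G.Adj p.1 p.2 ∧ π p.1 < π p.2), f s(p.1, p.2) := by
  symm
  refine sum_bij (fun p _ => s(p.1, p.2)) ?_ ?_ ?_ fun _ _ => rfl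
  · intro p hp
    simp only [mem_filter, mem_univ, true_and] at hp
    simpa using hp.1
  · rintro ⟨a, b⟩ hp ⟨c, d⟩ hq h
    simp only [mem_filter, mem_univ, true_and] at hp hq
    rcases Sym2.eq_iff.1 h with ⟨rfl, rfl⟩ | ⟨rfl, rfl⟩
    · rfl
    · exact absurd hp.2 (not_lt_of_gt hq.2)
  · intro e
    induction e using Sym2.ind with
    | _ a b =>
      intro he
      have hab : G.Adj a b := by simpa using he
      rcases lt_or_gt_of_ne (π.injective.ne hab.ne) with h | h
      · exact ⟨(a, b), by simp [hab, h], rfl⟩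
      · exact ⟨(b, a), by simp [hab.symm, h], Sym2.eq_swap⟩

/-- An edge is longer than one by the number of vertices it covers. -/
lemma sumEdgeLengths_eq_card_add_card_coveredTriples :
    G.sumEdgeLengths π = #G.edgeFinset + #(G.coveredTriples π) := by
  classical
  set O := univ.filter (fun p : V × V => G.Adj p.1 p.2 ∧ π p.1 < π p.2) with hO
  have hlen : ∀ p ∈ O, π.edgeLength s(p.1, p.2) =
      1 + #(univ.filter fun x => π p.1 < π x ∧ π x < π p.2) := by
    intro p hp
    simp only [hO, mem_filter, mem_univ, true_and] at hp
    have hcard : #(univ.filter fun x => π p.1 < π x ∧ π x < π p.2) = #(Ioo (π p.1) (π p.2)) :=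
      card_nbij' π π.symm (by intro x; simp) (by intro x; simp) (by intro x; simp)
        (by intro x; simp)
    rw [hcard, Fin.card_Ioo]
    have := hp.2
    simp only [LinearArrangement.edgeLength, Sym2.lift_mk]
    rw [Fin.lt_def] at this
    omega
  have hcov : #(G.coveredTriples π) =
      ∑ p ∈ O, #(univ.filter fun x => π p.1 < π x ∧ π x < π p.2) := by
    rw [card_eq_sum_card_fiberwise (f := fun t : V × V × V => (t.1, t.2.2)) (t := O)]
    · refine sum_congr rfl fun p hp => ?_
      simp only [hO, mem_filter, mem_univ, true_and] at hp
      refine card_nbij' (fun t => t.2.1) (fun x => (p.1, x, p.2)) ?_ ?_ ?_ ?_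
      · rintro ⟨u, x, v⟩ ht
        simp only [coveredTriples, coe_filter, mem_filter, mem_univ, true_and,
          Set.mem_ofPred_eq] at ht ⊢
        rw [← ht.2]
        exact ht.1.2
      · intro x hx
        simp only [coveredTriples, coe_filter, mem_filter, mem_univ, true_and,
          Set.mem_ofPred_eq] at hx ⊢
        exact ⟨⟨hp.1, hx⟩, trivial⟩
      · rintro ⟨u, x, v⟩ ht
        simp only [coveredTriples, coe_filter, mem_filter, mem_univ, true_and,
          Set.mem_ofPred_eq] at ht ⊢
        rw [← ht.2]
      · intro x _
        rfl
    · rintro ⟨u, x, v⟩ ht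
      simp only [coveredTriples, hO, coe_filter, mem_univ, true_and,
        Set.mem_ofPred_eq] at ht ⊢
      exact ⟨ht.1, ht.2.1.trans ht.2.2⟩
  have hE : #G.edgeFinset = ∑ _p ∈ O, 1 := by
    rw [card_eq_sum_ones, G.sum_edgeFinset_eq_sum_oriented π fun _ => 1]
  rw [sumEdgeLengths, G.sum_edgeFinset_eq_sum_oriented π, sum_congr rfl hlen, sum_add_distrib,
    hcov, hE]

/-- Triples tied to their left end `u` are the pairs of right neighbours of `u`. -/
lemma card_leftTiedTriples :
    #(G.leftTiedTriples π) = ∑ v, (#(G.rightNeighbors π v)).choose 2 := by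
  classical
  rw [card_eq_sum_card_fiberwise (f := fun t : V × V × V => t.1) (t := univ) (by simp)]
  refine sum_congr rfl fun u _ => ?_
  rw [← card_filter_lt_eq_choose_two _ π.injective]
  refine card_nbij' (fun t => t.2) (fun p => (u, p)) ?_ ?_ ?_ ?_
  · rintro ⟨u', x, v⟩ ht
    simp [leftTiedTriples, coveredTriples] at ht
    obtain ⟨⟨⟨h1, h2, h3⟩, h4⟩, rfl⟩ := ht
    simp [rightNeighbors, h1, h2, h3, h4, h2.trans h3]
  · rintro ⟨x, v⟩ hp
    simp [rightNeighbors] at hp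
    obtain ⟨⟨⟨h1, h2⟩, h3, h4⟩, h5⟩ := hp
    simp [leftTiedTriples, coveredTriples, h1, h2, h3, h5]
  · rintro ⟨u', x, v⟩ ht
    simp [leftTiedTriples, coveredTriples] at ht
    simp [ht.2]
  · intro p _
    rfl

/-- Triples tied to their right end `v` are the pairs of left neighbours of `v`. -/
lemma card_rightTiedTriples :
    #(G.rightTiedTriples π) = ∑ v, (#(G.leftNeighbors π v)).choose 2 := by
  classical
  rw [card_eq_sum_card_fiberwise (f := fun t : V × V × V => t.2.2) (t := univ) (by simp)]
  refine sum_congr rfl fun v _ => ?_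
  rw [← card_filter_lt_eq_choose_two _ π.injective]
  refine card_nbij' (fun t => (t.1, t.2.1)) (fun p => (p.1, p.2, v)) ?_ ?_ ?_ ?_
  · rintro ⟨u, x, v'⟩ ht
    simp [rightTiedTriples, coveredTriples] at ht
    obtain ⟨⟨⟨h1, h2, h3⟩, h4⟩, rfl⟩ := ht
    simp [leftNeighbors, h1.symm, h2, h3, h4.symm, h2.trans h3]
  · rintro ⟨u, x⟩ hp
    simp [leftNeighbors] at hp
    obtain ⟨⟨⟨h1, h2⟩, h3, h4⟩, h5⟩ := hp
    simp [rightTiedTriples, coveredTriples, h1.symm, h4, h3.symm, h5]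
  · rintro ⟨u, x, v'⟩ ht
    simp [rightTiedTriples, coveredTriples] at ht
    simp [ht.2]
  · intro p _
    rfl

/-- A vertex adjacent to both ends of an edge would close a triangle. -/
lemma disjoint_leftTiedTriples_rightTiedTriples (hG : G.CliqueFree 3) :
    Disjoint (G.leftTiedTriples π) (G.rightTiedTriples π) := by
  classical
  rw [Finset.disjoint_left]
  rintro ⟨u, x, v⟩ hl hr
  simp only [leftTiedTriples, rightTiedTriples, coveredTriples, mem_filter, mem_univ,
    true_and] at hl hr
  exact hG {u, x, v} (is3Clique_triple_iff.2 ⟨hl.2, hl.1.1, hr.2⟩)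

lemma card_leftTiedTriples_union_rightTiedTriples [DecidableEq V] (hG : G.CliqueFree 3) :
    #(G.leftTiedTriples π ∪ G.rightTiedTriples π) =
      ∑ v, ((#(G.leftNeighbors π v)).choose 2 + (#(G.rightNeighbors π v)).choose 2) := by
  rw [card_union_of_disjoint (G.disjoint_leftTiedTriples_rightTiedTriples π hG),
    card_leftTiedTriples, card_rightTiedTriples, sum_add_distrib, add_comm]

/-- The lower bound on the sum of edge lengths, valid in every triangle-free graph. -/
lemma card_add_sum_minSameSidePairs_le_sumEdgeLengths (hG : G.CliqueFree 3) :
    #G.edgeFinset + ∑ v, minSameSidePairs (G.degree v) ≤ G.sumEdgeLengths π := by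
  classical
  rw [sumEdgeLengths_eq_card_add_card_coveredTriples]
  refine Nat.add_le_add_left ?_ _
  calc ∑ v, minSameSidePairs (G.degree v)
      ≤ ∑ v, ((#(G.leftNeighbors π v)).choose 2 + (#(G.rightNeighbors π v)).choose 2) :=
        sum_le_sum fun v _ => by
          rw [← G.card_leftNeighbors_add_card_rightNeighbors π v]
          exact minSameSidePairs_le _ _
    _ = #(G.leftTiedTriples π ∪ G.rightTiedTriples π) :=
        (G.card_leftTiedTriples_union_rightTiedTriples π hG).symm
    _ ≤ #(G.coveredTriples π) :=
        card_le_card (union_subset (filter_subset _ _) (filter_subset _ _))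

/-- The lower bound is attained when edges cover only neighbours of their ends and every vertex
has its neighbours split evenly between its two sides. -/
lemma sumEdgeLengths_eq_of_tied_of_balanced (hG : G.CliqueFree 3)
    (htied : ∀ u x v, G.Adj u v → π u < π x → π x < π v → G.Adj u x ∨ G.Adj x v)
    (hleft : ∀ v, #(G.leftNeighbors π v) ≤ #(G.rightNeighbors π v) + 1)
    (hright : ∀ v, #(G.rightNeighbors π v) ≤ #(G.leftNeighbors π v) + 1) :
    G.sumEdgeLengths π = #G.edgeFinset + ∑ v, minSameSidePairs (G.degree v) := by
  classical
  have hcov : G.coveredTriples π = G.leftTiedTriples π ∪ G.rightTiedTriples π := by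
    rw [leftTiedTriples, rightTiedTriples, ← filter_or, filter_true_of_mem]
    rintro ⟨u, x, v⟩ ht
    simp only [coveredTriples, mem_filter, mem_univ, true_and] at ht
    exact htied u x v ht.1 ht.2.1 ht.2.2
  rw [sumEdgeLengths_eq_card_add_card_coveredTriples, hcov,
    G.card_leftTiedTriples_union_rightTiedTriples π hG]
  congr 1
  refine sum_congr rfl fun v _ => ?_
  rw [choose_two_add_choose_two_of_balanced (hleft v) (hright v),
    card_leftNeighbors_add_card_rightNeighbors]

end Counting


/-! ### Coordinates on a linear tree -/

lemma Connected.exists_adj_dist_add_one {W : Type*} {H : SimpleGraph W} (hH : H.Connected)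
    {a u : W} {d : ℕ} (hu : H.dist a u = d + 1) : ∃ w, H.Adj u w ∧ H.dist a w = d := by
  obtain ⟨p, hp⟩ := hH.exists_walk_length_eq_dist u a
  rw [dist_comm, hu] at hp
  cases p with
  | nil => simp at hp
  | @cons _ w _ h q =>
    refine ⟨w, h, ?_⟩
    have h1 : H.dist w a ≤ q.length := dist_le q
    have h2 : H.dist a u ≤ H.dist a w + H.dist w u := hH.dist_triangle
    have h3 : H.dist w u = 1 := dist_eq_one_iff_adj.2 h.symm
    rw [Walk.length_cons] at hp
    rw [dist_comm] at h1
    omega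

/-- From a vertex of degree at most one in a connected graph of maximum degree at most two,
the distance never branches. -/
lemma Connected.dist_injective_of_degree_le {W : Type*} {H : SimpleGraph W} [H.LocallyFinite]
    (hH : H.Connected) (hdeg : ∀ w, H.degree w ≤ 2) {a : W} (ha : H.degree a ≤ 1) :
    Function.Injective (H.dist a) := by
  classical
  suffices h : ∀ d u w, H.dist a u = d → H.dist a w = d → u = w from
    fun u w huw => h _ u w huw rfl
  intro d
  induction d with
  | zero =>
    intro u w hu hw
    rw [← hH.dist_eq_zero_iff.1 hu, ← hH.dist_eq_zero_iff.1 hw]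
  | succ d ih =>
    intro u w hu hw
    obtain ⟨u', huu', hu'⟩ := hH.exists_adj_dist_add_one hu
    obtain ⟨w', hww', hw'⟩ := hH.exists_adj_dist_add_one hw
    obtain rfl := ih u' w' hu' hw'
    by_contra hne
    rcases d with _ | d
    · obtain rfl := hH.dist_eq_zero_iff.1 hu'
      have hsub : ({u, w} : Finset W) ⊆ H.neighborFinset a := by
        simp [insert_subset_iff, huu'.symm, hww'.symm]
      have := card_le_card hsub
      rw [card_pair hne, card_neighborFinset_eq_degree] at this
      omega
    · obtain ⟨x, hx, hxd⟩ := hH.exists_adj_dist_add_one hu'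
      have hux : u ≠ x := by rintro rfl; omega
      have hwx : w ≠ x := by rintro rfl; omega
      have hsub : ({u, w, x} : Finset W) ⊆ H.neighborFinset u' := by
        simp [insert_subset_iff, huu'.symm, hww'.symm, hx]
      have h3 := card_le_card hsub
      rw [card_eq_three.2 ⟨u, w, x, hne, hux, hwx, rfl⟩, card_neighborFinset_eq_degree] at h3
      have := hdeg u'
      omega

/-- A finite linear tree embeds in the integers with adjacent vertices at consecutive points. -/
lemma IsLinearTree.exists_coordinate {W : Type*} [Finite W] {H : SimpleGraph W} [H.LocallyFinite]
    (hH : H.IsLinearTree) :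
    ∃ f : W → ℕ, f.Injective ∧ ∀ u v, H.Adj u v → f u = f v + 1 ∨ f v = f u + 1 := by
  classical
  have := Fintype.ofFinite W
  obtain ⟨a, ha⟩ : ∃ a, H.degree a ≤ 1 := by
    have := hH.1.1.nonempty
    rcases subsingleton_or_nontrivial W with h | h
    · refine ⟨Classical.arbitrary W, ?_⟩
      rw [← card_neighborFinset_eq_degree]
      exact card_le_one.2 fun x _ y _ => Subsingleton.elim x y
    · obtain ⟨a, ha⟩ := hH.1.exists_vert_degree_one_of_nontrivial
      refine ⟨a, le_of_eq ?_⟩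
      convert ha
  exact ⟨H.dist a, hH.1.1.dist_injective_of_degree_le hH.2 ha,
    fun u v h => (hH.1.dist_eq_dist_add_one_of_adj a h)⟩

/-! ### The arrangement of a caterpillar -/

/-- Every injective key into a linear order sorts the vertices into a linear arrangement. -/
lemma _root_.LinearArrangement.exists_lt_iff {V α : Type*} [Fintype V] [LinearOrder α]
    {κ : V → α} (hκ : κ.Injective) :
    ∃ π : LinearArrangement V, ∀ u v, π u < π v ↔ κ u < κ v := by
  let _ : LinearOrder V := LinearOrder.lift' κ hκ
  exact ⟨(monoEquivOfFin V rfl).symm.toEquiv, fun u v => (monoEquivOfFin V rfl).symm.lt_iff_lt⟩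

section Caterpillar

variable {V : Type*} [Fintype V] {G : SimpleGraph V} [DecidableRel G.Adj]

/-- In a connected graph two adjacent leaves are the only vertices. -/
lemma Connected.degree_eq_one_of_adj_leaves (hG : G.Connected) {u v : V} (huv : G.Adj u v)
    (hu : G.degree u = 1) (hv : G.degree v = 1) (w : V) : G.degree w = 1 := by
  have huniq : ∀ {a b c : V}, G.degree a = 1 → G.Adj a b → G.Adj a c → b = c :=
    fun h hb hc => (degree_eq_one_iff_existsUnique_adj.1 h).unique hb hc
  have key : ∀ (a : V) (p : G.Walk a w), a = u ∨ a = v → w = u ∨ w = v := by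
    intro a p
    induction p with
    | nil => exact id
    | cons h q ih =>
      rintro (rfl | rfl)
      · exact ih (.inr (huniq hu h huv))
      · exact ih (.inl (huniq hv h huv.symm))
  obtain ⟨p⟩ := hG.preconnected u w
  rcases key u p (.inl rfl) with rfl | rfl <;> assumption

/-- Each vertex has a base on the spine: itself, or the neighbour of a leaf. -/
lemma Connected.exists_spine_base (hG : G.Connected) (hne : ∃ s, G.degree s ≠ 1) :
    ∃ b : V → V, (∀ v, G.degree (b v) ≠ 1) ∧ (∀ v, G.degree v ≠ 1 → b v = v) ∧
      ∀ v w, G.degree v = 1 → G.Adj v w → b v = w := by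
  classical
  have h : ∀ v, ∃ s, G.degree s ≠ 1 ∧ (G.degree v ≠ 1 → s = v) ∧
      (G.degree v = 1 → ∀ w, G.Adj v w → s = w) := by
    intro v
    by_cases hv : G.degree v = 1
    · obtain ⟨s, hs, huniq⟩ := degree_eq_one_iff_existsUnique_adj.1 hv
      refine ⟨s, fun hs1 => ?_, fun h => absurd hv h, fun _ w hw => (huniq w hw).symm⟩
      obtain ⟨t, ht⟩ := hne
      exact ht (hG.degree_eq_one_of_adj_leaves hs hv hs1 t)
    · exact ⟨v, hv, fun _ => rfl, fun h => absurd h hv⟩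
  choose b hb using h
  exact ⟨b, fun v => (hb v).1, fun v => (hb v).2.1, fun v w h => (hb v).2.2 h w⟩

/-- At most one neighbour of `v` lies on a given side along an injective coordinate of the spine
that changes by one along edges; so some set of leaves at `v` completes the spine neighbours
preceding `v` to exactly half of the neighbours. -/
lemma exists_left_leaves {g : V → ℕ}
    (hinj : ∀ u v, G.degree u ≠ 1 → G.degree v ≠ 1 → g u = g v → u = v)
    (hadj : ∀ u v, G.degree u ≠ 1 → G.degree v ≠ 1 → G.Adj u v → g u = g v + 1 ∨ g v = g u + 1)
    (v : V) (hv : G.degree v ≠ 1) :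
    ∃ L : Finset V, (∀ w ∈ L, G.Adj v w ∧ G.degree w = 1) ∧
      #((G.neighborFinset v).filter fun w => G.degree w ≠ 1 ∧ g w < g v) + #L =
        G.degree v / 2 := by
  classical
  set N := G.neighborFinset v with hN
  set P := N.filter fun w => G.degree w ≠ 1 ∧ g w < g v with hP
  set Q := N.filter fun w => G.degree w ≠ 1 ∧ g v < g w with hQ
  set F := N.filter fun w => G.degree w = 1 with hF
  have hP1 : #P ≤ 1 := card_le_one.2 fun x hx y hy => by
    simp only [hP, hN, mem_filter, mem_neighborFinset] at hx hy
    have := hadj v x hv hx.2.1 hx.1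
    have := hadj v y hv hy.2.1 hy.1
    exact hinj x y hx.2.1 hy.2.1 (by omega)
  have hQ1 : #Q ≤ 1 := card_le_one.2 fun x hx y hy => by
    simp only [hQ, hN, mem_filter, mem_neighborFinset] at hx hy
    have := hadj v x hv hx.2.1 hx.1
    have := hadj v y hv hy.2.1 hy.1
    exact hinj x y hx.2.1 hy.2.1 (by omega)
  have hcover : N ⊆ P ∪ Q ∪ F := by
    intro w hw
    have hvw : G.Adj v w := by simpa [hN] using hw
    simp only [hP, hQ, hF, mem_union, mem_filter, hw, true_and]
    by_cases h : G.degree w = 1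
    · exact .inr h
    · have := hadj v w hv h hvw
      refine .inl ?_
      simp only [h, not_false_eq_true, ne_eq, true_and]
      omega
  have hcard : G.degree v ≤ #P + #Q + #F := by
    rw [← card_neighborFinset_eq_degree]
    exact (card_le_card hcover).trans
      ((card_union_le _ _).trans (Nat.add_le_add_right (card_union_le _ _) _))
  have hPdeg : #P ≤ G.degree v := by
    rw [← card_neighborFinset_eq_degree]
    exact card_le_card (filter_subset _ _)
  obtain ⟨L, hLF, hL⟩ := exists_subset_card_eq (s := F) (n := G.degree v / 2 - #P) (by omega)
  refine ⟨L, fun w hw => ?_, by omega⟩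
  have := hLF hw
  simpa [hF, hN] using this

/-- The spine vertices are laid out in order along the spine, each surrounded by its own leaves,
and the leaves are distributed so that every spine vertex has half of its neighbours on either
side. -/
lemma Connected.exists_tied_balanced_arrangement (hG : G.Connected)
    (hne : ∃ s, G.degree s ≠ 1) {f : V → ℕ}
    (hinj : ∀ u v, G.degree u ≠ 1 → G.degree v ≠ 1 → f u = f v → u = v)
    (hadj : ∀ u v, G.degree u ≠ 1 → G.degree v ≠ 1 → G.Adj u v → f u = f v + 1 ∨ f v = f u + 1) :
    ∃ π : LinearArrangement V,
      (∀ u x v, G.Adj u v → π u < π x → π x < π v → G.Adj u x ∨ G.Adj x v) ∧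
      (∀ v, #(G.leftNeighbors π v) ≤ #(G.rightNeighbors π v) + 1) ∧
      ∀ v, #(G.rightNeighbors π v) ≤ #(G.leftNeighbors π v) + 1 := by
  classical
  obtain ⟨b, hb, hbself, hbleaf⟩ := hG.exists_spine_base hne
  have hbadj : ∀ x, x = b x ∨ G.Adj x (b x) := by
    intro x
    by_cases hx : G.degree x = 1
    · obtain ⟨s, hs, -⟩ := degree_eq_one_iff_existsUnique_adj.1 hx
      exact .inr (by rwa [hbleaf x s hx hs])
    · exact .inl (hbself x hx).symm
  choose! L hLleaf hLcard using exists_left_leaves hinj hadj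
  -- Sorting is by block, then by side within the block, with ties broken arbitrarily.
  let σ : V → ℕ := fun w => if G.degree w ≠ 1 then 1 else if w ∈ L (b w) then 0 else 2
  let κ : V → ℕ ×ₗ ℕ ×ₗ Fin (Fintype.card V) := fun w =>
    toLex (f (b w), toLex (σ w, Fintype.equivFin V w))
  have hκ : κ.Injective := fun u v huv => by
    have := congrArg (fun t => (ofLex (ofLex t).2).2) huv
    exact (Fintype.equivFin V).injective this
  obtain ⟨π, hπ⟩ := LinearArrangement.exists_lt_iff hκ
  have hπ_block : ∀ u v, π u < π v → f (b u) ≤ f (b v) := fun u v h => by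
    rw [hπ, Prod.Lex.toLex_lt_toLex] at h
    rcases h with h | h
    · exact h.le
    · exact h.1.le
  have hlt_block : ∀ u v, f (b u) < f (b v) → π u < π v := fun u v h => by
    rw [hπ, Prod.Lex.toLex_lt_toLex]
    exact .inl h
  have hlt_side : ∀ u v, b u = b v → σ u < σ v → π u < π v := fun u v h h' => by
    rw [hπ, Prod.Lex.toLex_lt_toLex]
    exact .inr ⟨congrArg f h, Prod.Lex.toLex_lt_toLex.2 (.inl h')⟩
  -- An edge stays in one block or joins two consecutive spine vertices.
  have hedge : ∀ u v, G.Adj u v → b u = u ∧ b v = v ∧ (f u = f v + 1 ∨ f v = f u + 1) ∨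
      b v = u ∧ b u = u ∨ b u = v ∧ b v = v := by
    intro u v huv
    by_cases hu : G.degree u = 1
    · have h := hbleaf u v hu huv
      exact .inr (.inr ⟨h, hbself v (h ▸ hb u)⟩)
    · by_cases hv : G.degree v = 1
      · exact .inr (.inl ⟨hbleaf v u hv huv.symm, hbself u hu⟩)
      · exact .inl ⟨hbself u hu, hbself v hv, hadj u v hu hv huv⟩
  have htied : ∀ u x v, G.Adj u v → π u < π x → π x < π v → G.Adj u x ∨ G.Adj x v := by
    intro u x v huv hux hxv
    have h1 := hπ_block u x hux
    have h2 := hπ_block x v hxv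
    have hxu : x ≠ u := by rintro rfl; exact lt_irrefl _ hux
    have hxv' : x ≠ v := by rintro rfl; exact lt_irrefl _ hxv
    have hx : b x = b u ∨ b x = b v := by
      rcases hedge u v huv with ⟨hu, hv, h⟩ | ⟨hv, hu⟩ | ⟨hu, hv⟩
      · rw [← hu, ← hv] at h
        have : f (b x) = f (b u) ∨ f (b x) = f (b v) := by omega
        exact this.imp (hinj _ _ (hb x) (hb u)) (hinj _ _ (hb x) (hb v))
      · rw [hv, ← hu] at h2
        exact .inl (hinj _ _ (hb x) (hb u) (le_antisymm h2 h1))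
      · rw [hu, ← hv] at h1
        exact .inr (hinj _ _ (hb x) (hb v) (le_antisymm h2 h1))
    have hend : b x = u ∨ b x = v := by
      rcases hedge u v huv with ⟨hu, hv, -⟩ | ⟨hv, hu⟩ | ⟨hu, hv⟩ <;> rw [hu, hv] at hx <;> tauto
    rcases hbadj x with h | h
    · rcases hend with h' | h'
      · exact absurd (h.trans h') hxu
      · exact absurd (h.trans h') hxv'
    · rcases hend with h' | h'
      · exact .inl (h' ▸ h).symm
      · exact .inr (h' ▸ h)
  have hhalf : ∀ v, G.degree v ≠ 1 → #(G.leftNeighbors π v) = G.degree v / 2 := by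
    intro v hv
    have hσv : σ v = 1 := by simp [σ, hv]
    have hbv := hbself v hv
    have hleft : G.leftNeighbors π v =
        ((G.neighborFinset v).filter fun w => G.degree w ≠ 1 ∧ f w < f v) ∪ L v := by
      ext w
      simp only [leftNeighbors, mem_filter, mem_union, mem_neighborFinset]
      constructor
      · rintro ⟨hvw, hlt⟩
        by_cases hw : G.degree w = 1
        · right
          have hbw := hbleaf w v hw hvw.symm
          by_contra hwL
          have hσw : σ w = 2 := by simp [σ, hw, hbw, hwL]
          exact lt_asymm hlt (hlt_side v w (hbv.trans hbw.symm) (by omega))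
        · refine .inl ⟨hvw, hw, ?_⟩
          have h1 := hπ_block w v hlt
          rw [hbself w hw, hbv] at h1
          have := hadj v w hv hw hvw
          omega
      · rintro (⟨hvw, hw, hlt⟩ | hwL)
        · exact ⟨hvw, hlt_block w v (by rwa [hbself w hw, hbv])⟩
        · obtain ⟨hvw, hw⟩ := hLleaf v hv w hwL
          have hbw := hbleaf w v hw hvw.symm
          have hσw : σ w = 0 := by simp [σ, hw, hbw, hwL]
          exact ⟨hvw, hlt_side w v (hbw.trans hbv.symm) (by omega)⟩
    rw [hleft, card_union_of_disjoint, hLcard v hv]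
    rw [Finset.disjoint_left]
    intro w hw hwL
    exact (mem_filter.1 hw).2.1 (hLleaf v hv w hwL).2
  refine ⟨π, htied, fun v => ?_, fun v => ?_⟩ <;>
  · have hsum := G.card_leftNeighbors_add_card_rightNeighbors π v
    by_cases hv : G.degree v = 1
    · omega
    · have := hhalf v hv
      omega

/-- A caterpillar has an arrangement attaining the lower bound. -/
lemma IsCaterpillar.exists_sumEdgeLengths_eq (hG : G.IsCaterpillar) :
    ∃ π : LinearArrangement V,
      G.sumEdgeLengths π = #G.edgeFinset + ∑ v, minSameSidePairs (G.degree v) := by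
  classical
  have hfree : G.CliqueFree 3 := hG.1.isAcyclic.cliqueFree le_rfl
  obtain ⟨htree, hempty | hlin⟩ := hG
  · have hdeg : ∀ v, G.degree v = 1 := fun v => by
      by_contra h
      exact hempty.false ⟨v, h⟩
    -- A tree consisting of leaves alone has two vertices, so no edge covers a vertex.
    have hcard : Fintype.card V = 2 := by
      have h1 := G.sum_degrees_eq_twice_card_edges
      have h2 := htree.card_edgeFinset
      simp only [hdeg, sum_const, card_univ, smul_eq_mul, mul_one] at h1
      omega
    refine ⟨Fintype.equivFin V, G.sumEdgeLengths_eq_of_tied_of_balanced _ hfree ?_ ?_ ?_⟩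
    · intro u x v _ h1 h2
      rw [Fin.lt_def] at h1 h2
      have := (Fintype.equivFin V v).isLt
      omega
    all_goals
      intro v
      have := G.card_leftNeighbors_add_card_rightNeighbors (Fintype.equivFin V) v
      have := hdeg v
      omega
  · obtain ⟨f, hf, hfadj⟩ := hlin.exists_coordinate
    obtain ⟨s⟩ := hlin.1.1.nonempty
    let g : V → ℕ := fun v => if h : G.degree v ≠ 1 then f ⟨v, h⟩ else 0
    obtain ⟨π, h1, h2, h3⟩ := htree.1.exists_tied_balanced_arrangement ⟨s.1, s.2⟩ (f := g)
      (fun u v hu hv h => by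
        simp only [g, dif_pos hu, dif_pos hv] at h
        exact congrArg Subtype.val (hf h))
      (fun u v hu hv h => by
        simp only [g, dif_pos hu, dif_pos hv]
        exact hfadj ⟨u, hu⟩ ⟨v, hv⟩ h)
    exact ⟨π, G.sumEdgeLengths_eq_of_tied_of_balanced π hfree h1 h2 h3⟩

lemma IsCaterpillar.minSumEdgeLengths_eq [DecidableEq V] (hG : G.IsCaterpillar) :
    G.minSumEdgeLengths = #G.edgeFinset + ∑ v, minSameSidePairs (G.degree v) := by
  obtain ⟨π, hπ⟩ := hG.exists_sumEdgeLengths_eq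
  refine le_antisymm (hπ ▸ inf'_le _ (mem_univ π)) (le_inf' _ _ fun π _ => ?_)
  exact G.card_add_sum_minSameSidePairs_le_sumEdgeLengths π (hG.1.isAcyclic.cliqueFree le_rfl)

end Caterpillar

end SimpleGraph

theorem mainTheorem5 {V : Type*} [Fintype V] [DecidableEq V] (G : SimpleGraph V)
    [DecidableRel G.Adj] (hG : G.IsCaterpillar) :
    ((G.minSumEdgeLengths : ℤ) =
      (Fintype.card V : ℤ) - 1 + ∑ v, ⌊(1 / 4 : ℚ) * ((G.degree v : ℚ) - 1) ^ 2⌋) ∧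
    ((G.minSumEdgeLengths : ℤ) =
      (∑ v, ⌊(1 / 4 : ℚ) * ((G.degree v : ℚ) + 1) ^ 2⌋) - ((Fintype.card V : ℤ) - 1)) ∧
    ((G.minSumEdgeLengths : ℚ) =
      (1 / 4 : ℚ) * ((Fintype.card V : ℚ) * G.degreeSecondMoment + (G.numOddDegree : ℚ))) := by
  have hD := hG.minSumEdgeLengths_eq
  have hE := hG.1.card_edgeFinset
  have hdeg := G.sum_degrees_eq_twice_card_edges
  refine ⟨?_, ?_, ?_⟩
  · simp_rw [floor_quarter_sub_one_sq, ← Nat.cast_sum]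
    omega
  · simp_rw [floor_quarter_add_one_sq, sum_add_distrib, ← Nat.cast_sum]
    omega
  · have hn : (Fintype.card V : ℚ) ≠ 0 := by
      have : Fintype.card V ≠ 0 := by omega
      exact_mod_cast this
    have hsum := sum_congr (rfl : (univ : Finset V) = univ)
      fun v _ => four_mul_minSameSidePairs (G.degree v)
    rw [sum_add_distrib, sum_add_distrib, ← mul_sum, ← mul_sum, hdeg, ← card_filter] at hsum
    have key : 4 * G.minSumEdgeLengths = ∑ v, G.degree v ^ 2 + G.numOddDegree := by
      unfold SimpleGraph.numOddDegree
      omega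
    rw [SimpleGraph.degreeSecondMoment, mul_div_cancel₀ _ hn]
    have keyQ : (4 * G.minSumEdgeLengths : ℚ) = ∑ v, (G.degree v : ℚ) ^ 2 + G.numOddDegree := by
      exact_mod_cast key
    linarith
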